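/- Let $G$ be a countable group, $M\subset G$ a finite subset, $A$ a finite set, and $S=A^{A^M}$ the set of all maps $A^M\to A$. For a subset $N\subset G$ and $t\in (A^{A^N})^G$ let $\sigma_t\colon A^G\to A^G$ be the asynchronous non-uniform cellular automaton (ANUCA) with memory $N$ given by $\sigma_t(x)(g)=t(g)\big((g^{-1}x)|_N\big)$, where $(gx)(h)=x(g^{-1}h)$. An ANUCA is called invertible if it is bijective and its inverse map is an ANUCA with finite memory. Let $s\in S^G$ be asymptotic to a constant configuration $c\in S^G$, i.e. $s$ and $c$ agree outside some finite subset of $G$. Then: (i) If $G$ is amenable and $\sigma_s$ is injective, then $\sigma_s$ is invertible; if moreover $G$ is infinite, then $\sigma_c$ is invertible too. (ii) If $G$ is residually finite and both $\sigma_s$ and $\sigma_c$ are injective, then $\sigma_s$ and $\sigma_c$ are both invertible. Here $G$ is amenable if for every $\varepsilon>0$ and every finite $T\subset G$ there is a nonempty finite $F\subset G$ with $|TF|\le(1+\varepsilon)|F|$, and residually finite if the intersection of its finite-index subgroups is trivial. -/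

import Mathlib

open scoped Pointwise

namespace ANUCA

variable {G : Type*} [Group G] {A : Type*}

/-- The Bernoulli shift on configurations: `(g x)(h) = x (g⁻¹ h)`. -/
def shift (g : G) (x : G → A) : G → A := fun h => x (g⁻¹ * h)

/-- Two configurations are asymptotic if they agree outside a finite subset of `G`. -/
def Asymptotic {B : Type*} (x y : G → B) : Prop :=
  ∃ E : Set G, E.Finite ∧ ∀ g, g ∉ E → x g = y g

/-- A configuration is constant if it takes the same value at all elements of `G`. -/
def IsConstant {B : Type*} (c : G → B) : Prop := ∀ g h, c g = c h

/-- The set `S = A^(A^M)` of local defining maps with memory `M`. -/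
abbrev LocalMap (A : Type*) (M : Set G) : Type _ := (M → A) → A

/-- The asynchronous non-uniform cellular automaton with memory `M` and configuration of
local defining maps `s`, given by `σ_s(x)(g) = s(g)((g⁻¹ x)|_M)`. -/
def sigma {M : Set G} (s : G → LocalMap A M) (x : G → A) : G → A :=
  fun g => s g (fun m : M => shift g⁻¹ x m)

/-- `σ_s` is invertible: it is bijective and its inverse map is an asynchronous non-uniform
cellular automaton with finite memory. -/
def Invertible {M : Set G} (s : G → LocalMap A M) : Prop :=
  Function.Bijective (sigma s) ∧
    ∃ N : Set G, N.Finite ∧ ∃ t : G → LocalMap A N,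
      Function.LeftInverse (sigma t) (sigma s) ∧ Function.RightInverse (sigma t) (sigma s)

/-- Amenability by Følner's condition: for all `ε > 0` and all finite `T ⊆ G` there is a
nonempty finite `F ⊆ G` with `|T F| ≤ (1 + ε) |F|`. -/
def Amenable (G : Type*) [Group G] : Prop :=
  ∀ ε : ℝ, 0 < ε → ∀ T : Set G, T.Finite →
    ∃ F : Set G, F.Finite ∧ F.Nonempty ∧ ((T * F).ncard : ℝ) ≤ (1 + ε) * (F.ncard : ℝ)

end ANUCA

open scoped Pointwise

namespace ANUCA

/-! ### Finite perturbations of a constant rule -/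

section Basic

variable {G : Type*} [Group G] {A : Type*}

/-! Everything reduces to surjectivity of `sigma c`. As `s` and `c` differ on a finite set `E`, both
maps send {x : `sigma c x` = z off `E`} into the finite set of configurations equal to z off `E`.
One map is injective and the other onto, so both are bijections. Compactness then yields a finite
inverse window, uniform in `g` by translation away from `E`.

For surjectivity over residually finite groups, use periodic configurations. Over infinite amenable
groups, `sigma c` is pre-injective (translate differences away from `E`) and Myhill's theorem
applies. Finite groups are immediate. -/

theorem sigma_apply {M : Set G} (s : G → LocalMap A M) (x : G → A) (g : G) :
    sigma s x g = s g (fun m => x (g * m)) := by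
  simp [sigma, shift]

theorem sigma_apply_congr {M : Set G} {s : G → LocalMap A M} {x y : G → A} {g : G}
    (h : ∀ m ∈ M, x (g * m) = y (g * m)) : sigma s x g = sigma s y g := by
  rw [sigma_apply, sigma_apply]
  congr 1
  funext m
  exact h m m.2

theorem sigma_shift {M : Set G} {c : G → LocalMap A M} (hc : IsConstant c) (g : G) (x : G → A) :
    sigma c (shift g x) = shift g (sigma c x) := by
  funext h
  simp only [shift, sigma_apply, mul_assoc]
  rw [hc h (g⁻¹ * h)]

theorem shift_injective (g : G) : Function.Injective (shift g : (G → A) → G → A) := by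
  intro x y h
  funext k
  simpa [shift] using congrFun h (g * k)

theorem sigma_apply_eq_of_eq {M : Set G} {s c : G → LocalMap A M} {g : G} (h : s g = c g)
    (x : G → A) : sigma s x g = sigma c x g := by
  rw [sigma_apply, sigma_apply, h]

/-- If `σ_s` is injective and `s` is asymptotic to a constant `c` over an infinite group, then
`σ_c` is pre-injective. -/
theorem preinjective_of_injective [Infinite G] {M : Set G} (hM : M.Finite)
    {s c : G → LocalMap A M} (hc : IsConstant c) (hsc : Asymptotic s c)
    (hs : Function.Injective (sigma s)) {x y : G → A} (hxy : Asymptotic x y)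
    (h : sigma c x = sigma c y) : x = y := by
  obtain ⟨E, hE, hsE⟩ := hsc
  obtain ⟨D, hD, hxD⟩ := hxy
  -- This makes `gD` disjoint from `EM`, so cells in `E` never see the translated difference.
  obtain ⟨g, hg⟩ := ((hE.mul hM).mul hD.inv).exists_notMem
  refine shift_injective g (hs ?_)
  funext k
  by_cases hk : k ∈ E
  · refine sigma_apply_congr fun m hm => hxD _ fun hmem => hg ?_
    refine ⟨k * m, ⟨k, hk, m, hm, rfl⟩, (g⁻¹ * (k * m))⁻¹, by simpa using hmem, ?_⟩
    simp [mul_assoc]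
  · rw [sigma_apply_eq_of_eq (hsE k hk), sigma_apply_eq_of_eq (hsE k hk), sigma_shift hc,
      sigma_shift hc, h]

/-- A counting argument over the configurations agreeing with a given one off a finite set. -/
theorem injective_and_surjective_of_asymptotic [Finite A] {M : Set G} {s c : G → LocalMap A M}
    (hsc : Asymptotic s c) (hs : Function.Injective (sigma s))
    (hc : Function.Surjective (sigma c)) :
    Function.Injective (sigma c) ∧ Function.Surjective (sigma s) := by
  obtain ⟨E, hE, hsE⟩ := hsc
  have := hE.to_subtype
  have key : ∀ z : G → A, ∃ f k : {x : G → A // ∀ g ∉ E, sigma c x g = z g} →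
      {w : G → A // ∀ g ∉ E, w g = z g}, (∀ x, (f x).1 = sigma s x.1) ∧
      (∀ x, (k x).1 = sigma c x.1) ∧ Function.Surjective f ∧ Function.Injective k := by
    intro z
    have : Finite {w : G → A // ∀ g ∉ E, w g = z g} := by
      refine Finite.of_injective (fun w (e : E) => w.1 e) fun v w hvw => ?_
      ext g
      by_cases hg : g ∈ E
      · exact congrFun hvw ⟨g, hg⟩
      · rw [v.2 g hg, w.2 g hg]
    let f : {x : G → A // ∀ g ∉ E, sigma c x g = z g} → {w : G → A // ∀ g ∉ E, w g = z g} :=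
      fun x => ⟨sigma s x.1, fun g hg => by
        rw [sigma_apply_eq_of_eq (hsE g hg), x.2 g hg]⟩
    let k : {x : G → A // ∀ g ∉ E, sigma c x g = z g} → {w : G → A // ∀ g ∉ E, w g = z g} :=
      fun x => ⟨sigma c x.1, x.2⟩
    have hf : Function.Injective f := fun x y h => Subtype.ext (hs (congrArg Subtype.val h))
    have hk : Function.Surjective k := by
      rintro ⟨w, hw⟩
      obtain ⟨x, rfl⟩ := hc w
      exact ⟨⟨x, hw⟩, rfl⟩
    have := Finite.of_injective f hf
    exact ⟨f, k, fun _ => rfl, fun _ => rfl,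
      (hf.bijective_of_nat_card_le (Nat.card_le_card_of_surjective k hk)).2,
      (hk.bijective_of_nat_card_le (Nat.card_le_card_of_injective f hf)).1⟩
  constructor
  · intro x y hxy
    obtain ⟨-, k, -, hk, -, hinj⟩ := key (sigma c x)
    have hy : ∀ g ∉ E, sigma c y g = sigma c x g := fun g _ => (congrFun hxy g).symm
    exact congrArg Subtype.val (hinj (a₁ := ⟨x, fun _ _ => rfl⟩) (a₂ := ⟨y, hy⟩)
      (Subtype.ext (by rw [hk, hk]; exact hxy)))
  · intro z
    obtain ⟨f, -, hf, -, hsurj, -⟩ := key z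
    obtain ⟨x, hx⟩ := hsurj ⟨z, fun _ _ => rfl⟩
    exact ⟨x.1, by rw [← hf, hx]⟩

end Basic

/-! ### Compactness and finite inverse windows -/

section Compactness

variable {G : Type*} [Group G] {A : Type*}

theorem continuous_sigma_apply [TopologicalSpace A] [DiscreteTopology A] {M : Set G}
    (hM : M.Finite) (s : G → LocalMap A M) (g : G) : Continuous fun x : G → A => sigma s x g := by
  have := hM.to_subtype
  simp only [sigma_apply]
  exact (continuous_of_discreteTopology (f := s g)).comp (by fun_prop)

theorem surjective_of_finite_patterns [Finite A] {M : Set G} (hM : M.Finite)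
    {s : G → LocalMap A M}
    (h : ∀ (z : G → A) (K : Finset G), ∃ x, ∀ g ∈ K, sigma s x g = z g) :
    Function.Surjective (sigma s) := by
  let _ : TopologicalSpace A := ⊥
  have : DiscreteTopology A := ⟨rfl⟩
  intro z
  obtain ⟨x, hx⟩ := CompactSpace.iInter_nonempty
    (t := fun g : G => {x : G → A | sigma s x g = z g})
    (fun g => isClosed_eq (continuous_sigma_apply hM s g) continuous_const)
    (fun K => by
      obtain ⟨x, hx⟩ := h z K
      exact ⟨x, by simpa using hx⟩)
  exact ⟨x, funext fun g => by simpa using Set.mem_iInter.1 hx g⟩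

/-- Otherwise compactness of the set of pairs differing at `g` gives two distinct configurations
with one image. -/
theorem exists_finset_determines [Finite A] {M : Set G} (hM : M.Finite)
    {s : G → LocalMap A M} (hs : Function.Injective (sigma s)) (g : G) :
    ∃ K : Finset G, ∀ x y : G → A, (∀ h ∈ K, sigma s x h = sigma s y h) → x g = y g := by
  let _ : TopologicalSpace A := ⊥
  have : DiscreteTopology A := ⟨rfl⟩
  by_contra! hK
  have hclosed : IsClosed {p : (G → A) × (G → A) | p.1 g ≠ p.2 g} :=
    (isClosed_discrete {a : A × A | a.1 ≠ a.2}).preimage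
      (f := fun p : (G → A) × (G → A) => (p.1 g, p.2 g)) (by fun_prop)
  obtain ⟨⟨x, y⟩, hxy, h⟩ := hclosed.isCompact.inter_iInter_nonempty
    (fun h : G => {p : (G → A) × (G → A) | sigma s p.1 h = sigma s p.2 h})
    (fun h => isClosed_eq ((continuous_sigma_apply hM s h).comp continuous_fst)
      ((continuous_sigma_apply hM s h).comp continuous_snd))
    (fun K => by
      obtain ⟨x, y, h, hxy⟩ := hK K
      exact ⟨(x, y), hxy, by simpa using h⟩)
  have : x = y := hs (funext fun k => by simpa using Set.mem_iInter.1 h k)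
  exact hxy (by rw [this])

/-- A bijective `σ_s` is invertible once a finite window, uniform in `g`, determines `x g`. -/
theorem invertible_of_uniform_window {M : Set G} {s : G → LocalMap A M}
    (hs : Function.Bijective (sigma s)) {N : Set G} (hN : N.Finite)
    (h : ∀ g, ∀ x y : G → A, (∀ n ∈ N, sigma s x (g * n) = sigma s y (g * n)) → x g = y g) :
    Invertible s := by
  classical
  -- Adding 1 to the window supplies the default value `u 1` for patterns outside the image.
  refine ⟨hs, insert 1 N, hN.insert 1, fun g u =>
    if hu : ∃ x : G → A, ∀ n : ↥(insert 1 N), sigma s x (g * n) = u n then hu.choose g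
    else u ⟨1, Set.mem_insert _ _⟩, ?_⟩
  refine (fun hl : Function.LeftInverse _ _ => ⟨hl, hl.rightInverse_of_surjective hs.2⟩)
    fun x => ?_
  funext g
  rw [sigma_apply]
  have hu : ∃ x' : G → A, ∀ n : ↥(insert 1 N), sigma s x' (g * n) = sigma s x (g * n) :=
    ⟨x, fun _ => rfl⟩
  rw [dif_pos hu]
  exact h g _ _ fun n hn => hu.choose_spec ⟨n, Set.mem_insert_of_mem _ hn⟩

theorem exists_uniform_window_of_cofinite [Finite A] {M : Set G} (hM : M.Finite)
    {s : G → LocalMap A M} (hs : Function.Injective (sigma s)) {N D : Set G} (hN : N.Finite)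
    (hD : D.Finite)
    (h : ∀ g ∉ D, ∀ x y : G → A,
      (∀ n ∈ N, sigma s x (g * n) = sigma s y (g * n)) → x g = y g) :
    ∃ N' : Set G, N'.Finite ∧ ∀ g, ∀ x y : G → A,
      (∀ n ∈ N', sigma s x (g * n) = sigma s y (g * n)) → x g = y g := by
  choose K hK using exists_finset_determines hM hs
  refine ⟨N ∪ ⋃ g ∈ D, (fun k => g⁻¹ * k) '' (K g : Set G),
    hN.union (hD.biUnion fun g _ => (K g).finite_toSet.image _), fun g x y hxy => ?_⟩
  by_cases hg : g ∈ D
  · refine hK g x y fun k hk => ?_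
    simpa using hxy (g⁻¹ * k) (Or.inr (Set.mem_biUnion hg ⟨k, hk, rfl⟩))
  · exact h g hg x y fun n hn => hxy n (Or.inl hn)

theorem invertible_of_finite [Finite G] [Finite A] {M : Set G} {s : G → LocalMap A M}
    (hs : Function.Injective (sigma s)) : Invertible s :=
  invertible_of_uniform_window ⟨hs, Finite.surjective_of_injective hs⟩ (Set.toFinite Set.univ)
    fun g x y h => by
      rw [hs (funext fun k => by simpa using h (g⁻¹ * k) trivial : sigma s x = sigma s y)]

/-- A window `K` for `c` at 1 translates to every `g`, and serves `s` too when `gK` misses `E`, that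
is, when `g ∉ E * K⁻¹`. -/
theorem invertible_of_asymptotic [Finite A] {M : Set G} (hM : M.Finite)
    {s c : G → LocalMap A M} (hc : IsConstant c) (hsc : Asymptotic s c)
    (hs : Function.Bijective (sigma s)) (hci : Function.Injective (sigma c)) :
    Invertible s := by
  obtain ⟨E, hE, hsE⟩ := hsc
  obtain ⟨K, hK⟩ := exists_finset_determines hM hci 1
  obtain ⟨N, hN, h⟩ := exists_uniform_window_of_cofinite hM hs.1 K.finite_toSet
    (hE.mul K.finite_toSet.inv) fun g hg x y hxy => by
      have := hK (shift g⁻¹ x) (shift g⁻¹ y) fun k hk => by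
        have hgk : g * k ∉ E := fun hmem =>
          hg ⟨g * k, hmem, k⁻¹, by simpa using hk, by simp⟩
        have := hxy k hk
        rw [sigma_apply_eq_of_eq (hsE _ hgk), sigma_apply_eq_of_eq (hsE _ hgk)] at this
        simpa [sigma_shift hc, shift] using this
      simpa [shift] using this
  exact invertible_of_uniform_window hs hN h

end Compactness

/-! ### Surjectivity over residually finite groups -/

section ResiduallyFinite

variable {G : Type*} [Group G] {A : Type*}

theorem exists_finite_quotient_injOn (hG : Group.ResiduallyFinite G) (K : Finset G) :
    ∃ H : Subgroup G, H.Normal ∧ H.FiniteIndex ∧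
      Set.InjOn (QuotientGroup.mk : G → G ⧸ H) (K : Set G) := by
  have h : ∀ p : {p : K × K // p.1 ≠ p.2},
      ∃ H : FiniteIndexNormalSubgroup G, (p.1.1.1)⁻¹ * p.1.2.1 ∉ H := fun p =>
    Group.exists_finiteIndexNormalSubgroup_notMem _ fun he =>
      p.2 (Subtype.ext (inv_mul_eq_one.1 he))
  choose H hH using h
  refine ⟨⨅ p, (H p).toSubgroup, Subgroup.normal_iInf_normal fun p => inferInstance,
    Subgroup.finiteIndex_iInf fun p => inferInstance, fun a ha b hb hab => ?_⟩
  by_contra hne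
  exact hH ⟨(⟨a, ha⟩, ⟨b, hb⟩), fun he => hne (congrArg Subtype.val he)⟩
    (Subgroup.mem_iInf.1 (QuotientGroup.eq.1 hab) _)

/-- On configurations pulled back from a finite quotient, `sigma c` is an injective self-map of a
finite set, hence onto; a quotient injective on `K` realises any pattern on `K`. -/
theorem surjective_of_injective_of_residuallyFinite [Finite A] (hG : Group.ResiduallyFinite G)
    {M : Set G} (hM : M.Finite) {c : G → LocalMap A M} (hc : IsConstant c)
    (hi : Function.Injective (sigma c)) : Function.Surjective (sigma c) := by
  refine surjective_of_finite_patterns hM fun z K => ?_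
  obtain ⟨H, hH, hfin, hinj⟩ := exists_finite_quotient_injOn hG K
  let τ : (G ⧸ H → A) → G ⧸ H → A := fun f q => c 1 fun m => f (q * QuotientGroup.mk m.1)
  have hτ : ∀ f g, sigma c (fun k => f (QuotientGroup.mk k)) g = τ f (QuotientGroup.mk g) := by
    intro f g
    rw [sigma_apply, hc g 1]
    rfl
  have hτi : Function.Injective τ := by
    intro f f' hff'
    have h := hi (a₁ := fun k => f (QuotientGroup.mk k)) (a₂ := fun k => f' (QuotientGroup.mk k))
      (funext fun g => by rw [hτ, hτ, hff'])
    funext q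
    induction q using QuotientGroup.induction_on with
    | H g => exact congrFun h g
  obtain ⟨f, hf⟩ := Finite.surjective_of_injective hτi
    fun q => z (Function.invFunOn (QuotientGroup.mk : G → G ⧸ H) (K : Set G) q)
  refine ⟨fun k => f (QuotientGroup.mk k), fun g hg => ?_⟩
  rw [hτ, hf]
  exact congrArg z (hinj.leftInvOn_invFunOn hg)

end ResiduallyFinite

/-! ### Myhill's theorem over amenable groups -/

section Amenable

variable {G : Type*} [Group G] {A : Type*}

open scoped Classical in
theorem Amenable.exists_finset (hG : Amenable G) {ε : ℝ} (hε : 0 < ε) (K : Finset G) :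
    ∃ F : Finset G, F.Nonempty ∧ ((F * K).card : ℝ) ≤ (1 + ε) * F.card := by
  -- Inversion turns the left Følner condition into a right one.
  obtain ⟨F, hF, hne, h⟩ := hG ε hε (K⁻¹ : Finset G) (Finset.finite_toSet _)
  lift F to Finset G using hF
  refine ⟨F⁻¹, by simpa using hne, ?_⟩
  rw [← Finset.coe_mul, Set.ncard_coe_finset, Set.ncard_coe_finset] at h
  rwa [Finset.card_inv, ← Finset.card_inv (F⁻¹ * K), mul_inv_rev, inv_inv]

/-- A maximal family of disjoint left translates of `B` by elements of `F`. -/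
theorem exists_packing (F : Finset G) {B : Finset G} (hB : B.Nonempty) :
    ∃ T ⊆ F, (∀ t ∈ T, ∀ t' ∈ T, ∀ b ∈ B, ∀ b' ∈ B, t * b = t' * b' → t = t') ∧
      F.card ≤ T.card * (B.card * B.card) := by
  let _ := Classical.decEq G
  obtain ⟨T, hT, hmax⟩ := Finset.exists_max_image
    (F.powerset.filter fun T =>
      ∀ t ∈ T, ∀ t' ∈ T, ∀ b ∈ B, ∀ b' ∈ B, t * b = t' * b' → t = t') Finset.card
    ⟨∅, by simp⟩
  rw [Finset.mem_filter, Finset.mem_powerset] at hT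
  refine ⟨T, hT.1, hT.2, ?_⟩
  -- By maximality, each `fB` meets some `tB`.
  have hsub : F ⊆ T * (B * B⁻¹) := by
    intro f hf
    by_cases hfT : f ∈ T
    · obtain ⟨b, hb⟩ := hB
      exact Finset.mem_mul.2 ⟨f, hfT, 1, Finset.mem_mul.2 ⟨b, hb, b⁻¹, by simpa using hb, by simp⟩,
        by simp⟩
    · by_contra hn
      have hne : ∀ t ∈ T, ∀ b ∈ B, ∀ b' ∈ B, t * b ≠ f * b' := by
        intro t ht b hb b' hb' he
        refine hn (Finset.mem_mul.2 ⟨t, ht, b * b'⁻¹,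
          Finset.mem_mul.2 ⟨b, hb, b'⁻¹, by simpa using hb', rfl⟩, ?_⟩)
        rw [← mul_assoc, he, mul_inv_cancel_right]
      have := hmax (insert f T) (by
        rw [Finset.mem_filter, Finset.mem_powerset]
        refine ⟨Finset.insert_subset hf hT.1, ?_⟩
        intro t ht t' ht' b hb b' hb' he
        rcases Finset.mem_insert.1 ht with htf | htT <;>
          rcases Finset.mem_insert.1 ht' with htf' | htT'
        · rw [htf, htf']
        · exact absurd (htf ▸ he).symm (hne _ htT' _ hb' _ hb)
        · exact absurd (htf' ▸ he) (hne _ htT _ hb _ hb')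
        · exact hT.2 t htT t' htT' b hb b' hb' he)
      rw [Finset.card_insert_of_notMem hfT] at this
      omega
  calc F.card ≤ (T * (B * B⁻¹)).card := Finset.card_le_card hsub
    _ ≤ T.card * (B * B⁻¹).card := Finset.card_mul_le
    _ ≤ T.card * (B.card * B.card) := by
      gcongr
      simpa using Finset.card_mul_le (s := B) (t := B⁻¹)

theorem exists_mul_pow_pred_lt {q k : ℕ} (hk : 0 < k) : ∃ n, 0 < n ∧ q * (k - 1) ^ n < k ^ n := by
  have hk' : (0 : ℝ) < k := by exact_mod_cast hk
  have hr : ((k - 1 : ℕ) : ℝ) / k < 1 := by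
    rw [div_lt_one hk']
    exact_mod_cast Nat.sub_lt hk one_pos
  have hlim := ((tendsto_pow_atTop_nhds_zero_of_lt_one (by positivity) hr).const_mul (q : ℝ))
  rw [mul_zero] at hlim
  obtain ⟨n, hn, hn0⟩ := ((hlim.eventually (gt_mem_nhds one_pos)).and
    (Filter.eventually_gt_atTop 0)).exists
  refine ⟨n, hn0, ?_⟩
  rw [div_pow, ← mul_div_assoc, div_lt_one (by positivity)] at hn
  exact_mod_cast hn

open scoped Classical in
/-- Counting the images of the configurations supported in `F` when some pattern on `B` never
appears in the image of a pre-injective cellular automaton. -/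
theorem card_pow_le_of_missing_pattern [Finite A] {M : Set G} {c : G → LocalMap A M}
    (hc : IsConstant c)
    (hpre : ∀ x y : G → A, Asymptotic x y → sigma c x = sigma c y → x = y)
    {z : G → A} {F B T W : Finset G} (hz : ∀ x, ∃ g ∈ B, sigma c x g ≠ z g)
    (hM : ∀ f ∈ F, ∀ m ∈ M, f * m⁻¹ ∈ W) (hTW : T * B ⊆ W)
    (hT : ∀ t ∈ T, ∀ t' ∈ T, ∀ b ∈ B, ∀ b' ∈ B, t * b = t' * b' → t = t') :
    Nat.card A ^ F.card * (Nat.card A ^ B.card) ^ T.card ≤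
      Nat.card A ^ W.card * (Nat.card A ^ B.card - 1) ^ T.card := by
  have := Fintype.ofFinite A
  let ext : (F → A) → G → A := fun u g => if h : g ∈ F then u ⟨g, h⟩ else z g
  let p : B → A := fun b => z b
  have hext : ∀ u v, Asymptotic (ext u) (ext v) := fun u v =>
    ⟨F, F.finite_toSet, fun g hg => by simp [ext, Finset.mem_coe.not.1 hg]⟩
  have hp : ∀ x : G → A, ∀ t : G, (fun b : B => sigma c x (t * b)) ≠ p := by
    intro x t he
    obtain ⟨b, hb, hne⟩ := hz (shift t⁻¹ x)
    refine hne ?_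
    rw [sigma_shift hc]
    simpa [shift] using congrFun he ⟨b, hb⟩
  -- Images agree off `W`, so `Φ` determines them; each tile `tB` omits the pattern `p`.
  let Φ : (F → A) → (↥(W \ (T * B)) → A) × (T → {f : B → A // f ≠ p}) := fun u =>
    (fun g => sigma c (ext u) g, fun t => ⟨fun b => sigma c (ext u) (t * b), hp _ _⟩)
  have hΦ : Function.Injective Φ := by
    intro u v huv
    have h1 := congrFun (congrArg Prod.fst huv)
    have h2 := fun t => congrFun (congrArg Subtype.val (congrFun (congrArg Prod.snd huv) t))
    have hσ : sigma c (ext u) = sigma c (ext v) := by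
      funext g
      by_cases hgW : g ∈ W
      · by_cases hg : g ∈ T * B
        · obtain ⟨t, ht, b, hb, rfl⟩ := Finset.mem_mul.1 hg
          exact h2 ⟨t, ht⟩ ⟨b, hb⟩
        · exact h1 ⟨g, Finset.mem_sdiff.2 ⟨hgW, hg⟩⟩
      · refine sigma_apply_congr fun m hm => ?_
        have : g * m ∉ F := fun hF => hgW (by simpa using hM _ hF m hm)
        simp [ext, this]
    have he := hpre _ _ (hext u v) hσ
    funext ⟨g, hg⟩
    simpa [ext, hg] using congrFun he g
  have hcard := Fintype.card_le_of_injective Φ hΦ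
  have hTB : (T * B).card = T.card * B.card := by
    rw [Finset.card_mul_iff]
    rintro ⟨t, b⟩ ⟨ht, hb⟩ ⟨t', b'⟩ ⟨ht', hb'⟩ he
    obtain rfl := hT t ht t' ht' b hb b' hb' he
    simpa using he
  have hW : W.card = (W \ (T * B)).card + T.card * B.card := by
    rw [← hTB, Finset.card_sdiff_add_card_eq_card hTW]
  have hsub : Fintype.card {f : B → A // f ≠ p} = Nat.card A ^ B.card - 1 := by
    rw [Fintype.card_subtype_compl, Fintype.card_subtype_eq]
    simp
  simp only [Fintype.card_prod, Fintype.card_fun, Fintype.card_coe, hsub,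
    ← Nat.card_eq_fintype_card (α := A)] at hcard
  calc _ ≤ Nat.card A ^ (W \ (T * B)).card * (Nat.card A ^ B.card - 1) ^ T.card *
        (Nat.card A ^ B.card) ^ T.card := Nat.mul_le_mul_right _ hcard
    _ = _ := by rw [hW, pow_add, ← pow_mul, mul_comm T.card]; ring

/-- Myhill's theorem: a pre-injective cellular automaton over an amenable group is surjective. -/
theorem Amenable.surjective_of_preinjective [Finite A] (hG : Amenable G) {M : Set G}
    (hM : M.Finite) {c : G → LocalMap A M} (hc : IsConstant c)
    (hpre : ∀ x y : G → A, Asymptotic x y → sigma c x = sigma c y → x = y) :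
    Function.Surjective (sigma c) := by
  classical
  refine surjective_of_finite_patterns hM fun z K => ?_
  by_contra! hK
  have hB : K.Nonempty := (hK z).imp fun _ h => h.1
  have : Nonempty A := ⟨z 1⟩
  have hq : 0 < Nat.card A := Nat.card_pos
  obtain ⟨n, hn, hlt⟩ := exists_mul_pow_pred_lt (q := Nat.card A) (pow_pos hq K.card)
  have hb : 0 < K.card := hB.card_pos
  lift M to Finset G using hM
  -- With |F| ≤ |T||K|², this ε bounds the excess d = |W| - |F| by |T|/n.
  obtain ⟨F, hF, hW⟩ := hG.exists_finset (ε := 1 / (n * (K.card * K.card))) (by positivity)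
    (insert 1 (M⁻¹ ∪ K))
  obtain ⟨T, hTF, hT, hFT⟩ := exists_packing F hB
  set W := F * insert 1 (M⁻¹ ∪ K)
  have hcount := card_pow_le_of_missing_pattern hc hpre (F := F) (W := W) hK
    (fun f hf m hm => Finset.mul_mem_mul hf (by simp [Finset.mem_coe.1 hm]))
    (Finset.mul_subset_mul hTF fun k hk => by simp [hk]) hT
  have hFW : F.card ≤ W.card :=
    Finset.card_le_card fun f hf => Finset.mem_mul.2 ⟨f, hf, 1, by simp, by simp⟩
  have hT0 : 0 < T.card := by
    by_contra h0
    have := hF.card_pos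
    simp_all
  obtain ⟨d, hd⟩ := Nat.exists_eq_add_of_le hFW
  have hnd : d * n ≤ T.card := by
    have h1 : (F.card : ℝ) ≤ T.card * (K.card * K.card) := by exact_mod_cast hFT
    have hn' : (0 : ℝ) < n := by exact_mod_cast hn
    have hb' : (0 : ℝ) < K.card := by exact_mod_cast hb
    have h2 : (d : ℝ) ≤ F.card / (n * (K.card * K.card)) := by
      rw [hd] at hW
      push_cast at hW
      rw [add_mul, one_mul, one_div_mul_eq_div] at hW
      linarith
    rw [le_div_iff₀ (by positivity)] at h2
    have h3 : (d * n : ℝ) * (K.card * K.card) ≤ T.card * (K.card * K.card) := by linarith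
    exact_mod_cast le_of_mul_le_mul_right h3 (by positivity)
  rw [hd, pow_add, mul_assoc] at hcount
  -- With q = |A| and k = q^|K|, the n-th power gives k^(n|T|) ≤ (q(k-1)^n)^|T| < k^(n|T|), by the
  -- choice of n.
  have h1 := Nat.pow_le_pow_left (Nat.le_of_mul_le_mul_left hcount (pow_pos hq _)) n
  have h2 : (Nat.card A ^ d * (Nat.card A ^ K.card - 1) ^ T.card) ^ n ≤
      (Nat.card A * (Nat.card A ^ K.card - 1) ^ n) ^ T.card := by
    rw [mul_pow, mul_pow, ← pow_mul, ← pow_mul, ← pow_mul, mul_comm T.card n]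
    gcongr
  have h3 := Nat.pow_lt_pow_left hlt hT0.ne'
  have h4 : ((Nat.card A ^ K.card) ^ n) ^ T.card = ((Nat.card A ^ K.card) ^ T.card) ^ n :=
    pow_right_comm _ _ _
  omega

end Amenable

end ANUCA

theorem theoremB {G : Type*} [Group G] [Countable G] {A : Type*} [Finite A]
    (M : Set G) (hM : M.Finite) (s c : G → ANUCA.LocalMap A M)
    (hc : ANUCA.IsConstant c) (hsc : ANUCA.Asymptotic s c) :
    (ANUCA.Amenable G → Function.Injective (ANUCA.sigma s) →
      ANUCA.Invertible s ∧ (Infinite G → ANUCA.Invertible c)) ∧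
    (Group.ResiduallyFinite G → Function.Injective (ANUCA.sigma s) →
      Function.Injective (ANUCA.sigma c) → ANUCA.Invertible s ∧ ANUCA.Invertible c) := by
  have key : Function.Injective (ANUCA.sigma s) → Function.Surjective (ANUCA.sigma c) →
      ANUCA.Invertible s ∧ ANUCA.Invertible c := by
    intro hs hcs
    obtain ⟨hci, hss⟩ := ANUCA.injective_and_surjective_of_asymptotic hsc hs hcs
    exact ⟨ANUCA.invertible_of_asymptotic hM hc hsc ⟨hs, hss⟩ hci,
      ANUCA.invertible_of_asymptotic hM hc ⟨∅, Set.finite_empty, fun _ _ => rfl⟩ ⟨hci, hcs⟩ hci⟩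
  refine ⟨fun hG hs => ?_, fun hG hs hci => key hs
    (ANUCA.surjective_of_injective_of_residuallyFinite hG hM hc hci)⟩
  rcases finite_or_infinite G with hfin | hinf
  · exact ⟨ANUCA.invertible_of_finite hs, fun hinf => (not_finite G).elim⟩
  · have h := key hs (hG.surjective_of_preinjective hM hc fun x y hxy h =>
      ANUCA.preinjective_of_injective hM hc hsc hs hxy h)
    exact ⟨h.1, fun _ => h.2⟩
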